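/- Let $n\ge 2$ and $1\le k\le n-1$, and let $$X(t)=\begin{pmatrix} a_1(t) & 1\\ b_1(t) & a_2(t) & \ddots\\ & \ddots & \ddots & 1\\ & & b_{n-1}(t) & a_n(t)\end{pmatrix}$$ be a real tridiagonal Hessenberg matrix evolving by the continuous-time Toda flow $\dot X=[X,\pi_-(X)]$, where $\pi_-(X)$ denotes the strictly lower triangular part of $X$. Here a flow is a function on $\mathbb R$ such that, at each time $t$, either the equation holds at $t$, or $X$ has a pole at $t$ (all entries are meromorphic at $t$ and at least one of them is infinite there); in particular every solution that exists on all of $\mathbb R$ is a flow. Suppose that $t=0$ is not a pole, that $b_j(0)\neq 0$ for $1\le j\le n-1$, and that $X(0)$ has $n$ distinct real eigenvalues $\lambda_1>\lambda_2>\cdots>\lambda_n$. Then the equation holds at $t$ and at $-t$ for all sufficiently large $t$, and $$\lim_{t\to+\infty} b_{n-k}(t)\,b_k(-t)\,e^{2(\lambda_{n-k}-\lambda_{n-k+1})t}=\frac{\prod_{j=1}^{k}(\lambda_{n-k}-\lambda_{n-j+1})^2\;\prod_{j=k+1}^{n}(\lambda_{n-k+1}-\lambda_{n-j+1})^2}{\prod_{j=k+2}^{n}(\lambda_{n-k}-\lambda_{n-j+1})^2\;\prod_{j=1}^{k-1}(\lambda_{n-k+1}-\lambda_{n-j+1})^2}.$$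 -/

import Mathlib

open Filter Topology

/-- The `n × n` tridiagonal lower Hessenberg matrix with diagonal entries `a 1, …, a n`,
superdiagonal entries `1` and subdiagonal entries `b 1, …, b (n - 1)`
(the labels of `a` and `b` start at `1`, the matrix positions in `Fin n` start at `0`;
the values `a 0`, `b 0`, `b n`, and all later ones, are not used). -/
def hessenberg (n : ℕ) (a b : ℕ → ℝ) : Matrix (Fin n) (Fin n) ℝ :=
  Matrix.of fun i j =>
    if (i : ℕ) = j then a (i + 1)
    else if (j : ℕ) = i + 1 then 1
    else if (i : ℕ) = j + 1 then b (j + 1)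
    else 0

/-- The projection `π₋` of a square matrix onto its strictly lower triangular part. -/
def strictLower {n : ℕ} (M : Matrix (Fin n) (Fin n) ℝ) : Matrix (Fin n) (Fin n) ℝ :=
  Matrix.of fun i j => if j < i then M i j else 0

/-- The matrix `X(t)` with diagonal entries `a j t` and subdiagonal entries `b j t`. -/
def todaMatrix (n : ℕ) (a b : ℕ → ℝ → ℝ) (t : ℝ) : Matrix (Fin n) (Fin n) ℝ :=
  hessenberg n (fun j => a j t) (fun j => b j t)

/-- The Toda Lax equation `dX/dt = [X, π₋(X)]` holds at the time `t` (entry by entry). -/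
def TodaRegularAt (n : ℕ) (a b : ℕ → ℝ → ℝ) (t : ℝ) : Prop :=
  ∀ i j : Fin n, HasDerivAt (fun s => todaMatrix n a b s i j)
    (⁅todaMatrix n a b t, strictLower (todaMatrix n a b t)⁆ i j) t

/-- The matrix `X` has a pole at the time `t`: all its entries are meromorphic at `t` and at
least one of them is infinite there. The values of `a` and `b` at `t` itself play no role. -/
def TodaPoleAt (n : ℕ) (a b : ℕ → ℝ → ℝ) (t : ℝ) : Prop :=
  (∀ i j : Fin n, MeromorphicAt (fun s => todaMatrix n a b s i j) t) ∧
    ∃ i j : Fin n, Tendsto (fun s => |todaMatrix n a b s i j|) (𝓝[≠] t) atTop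

/-- `a`, `b` is a Toda flow on `n × n` tridiagonal Hessenberg matrices: a solution of the Toda
Lax equation on the real line, continued meromorphically through its poles, if it has any.
Any solution that is differentiable on all of `ℝ` is an instance. -/
def IsTodaFlow (n : ℕ) (a b : ℕ → ℝ → ℝ) : Prop :=
  ∀ t : ℝ, TodaRegularAt n a b t ∨ TodaPoleAt n a b t

/-!
The proof integrates the Toda flow through the spectral measure of the vector `e₀`, which
linearizes it, and reads the subdiagonal entries off this measure.

*Linearization.* Write `X(t)` for the matrix and `m_t(p) = p(X(t))₀₀` for its moments. The first
row of `π₋(X)` is zero, so the Lax equation gives `m_t(p)' = m_t(X p) - m_t(X) m_t(p)`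
(`TodaRegularAt.hasDerivAt_moment`). Let `S` be the spectrum of `X(0)`, and let `c x` be the value
of `m_0` at the Lagrange basis polynomial of `x ∈ S`. The expected solution is
`m_t(p) = ∑ x, p(x) c x exp (x t) / ∑ x, c x exp (x t)`. The defect of this formula,
cleared of denominators, solves a homogeneous linear equation at regular times and is meromorphic
at poles. Hence around each time it vanishes identically or nowhere
(Grönwall's inequality, respectively the isolation of zeros),
the time itself excepted, and since the line is connected it vanishes identically
(`eventually_punctured_of_dichotomy`, `IsTodaFlow.moment_mul_expSum`). The same argument shows
that the nodal polynomial of `S` keeps annihilating the first row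
(`IsTodaFlow.row_aeval_eq_zero`), so that only the points of `S` carry mass at later times.

*Inversion.* For the Newton polynomials `π p = ∏ j < p, (X - μ j)` the first row of `π p (X)` is
supported on the first `p + 1` positions with last entry `1`, and the first column likewise with
last entry `b 1 ⋯ b p`. So the Gram determinant of `π 0, …, π (k - 1)` for the moments is
`∏ p < k, b 1 ⋯ b p` (`det_moment_newtonPoly`), and `b k` is a ratio of such determinants
(`subdiagonal_eq_of_det_expGram`). At time `0` the one of full size is nonzero, which forces all
weights `c x` to be nonzero (`spectralWeight_ne_zero`).

*Asymptotics.* Let `μ` list the eigenvalues by decreasing dominance, that is, decreasingly for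
`t → +∞` and increasingly for `t → -∞`. Since `π q` vanishes at `μ p` for `p < q`, the Gram matrix
with its rows divided by `exp (μ p t)` has a triangular limit, whose determinant is
`∏ p < k, c (μ p) (π p (μ p))²` (`tendsto_det_expGram`). So the determinants are nonzero
at large times, which excludes poles there (`IsTodaFlow.regularAt_of_det_expGram_ne_zero`), and
each subdiagonal entry has an explicit exponential asymptotic
(`IsTodaFlow.tendsto_subdiagonal`).
The product in the theorem pairs the same two consecutive eigenvalues at `+∞`
and at `-∞`, so that their unknown weights cancel.
-/

open Polynomial Matrix

/-! ### Newton polynomials of a Hessenberg matrix -/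

/-- The Newton polynomial `∏ j < p, (X - μ j)`. -/
noncomputable def newtonPoly (μ : ℕ → ℝ) (p : ℕ) : ℝ[X] :=
  ∏ j ∈ Finset.range p, (X - C (μ j))

theorem newtonPoly_succ (μ : ℕ → ℝ) (p : ℕ) :
    newtonPoly μ (p + 1) = newtonPoly μ p * (X - C (μ p)) :=
  Finset.prod_range_succ _ _

theorem eval_newtonPoly (μ : ℕ → ℝ) (p : ℕ) (x : ℝ) :
    (newtonPoly μ p).eval x = ∏ j ∈ Finset.range p, (x - μ j) := by
  simp [newtonPoly, eval_prod]

theorem eval_newtonPoly_of_lt (μ : ℕ → ℝ) {i p : ℕ} (h : i < p) :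
    (newtonPoly μ p).eval (μ i) = 0 := by
  rw [eval_newtonPoly]
  exact Finset.prod_eq_zero (Finset.mem_range.2 h) (sub_self _)

theorem eval_newtonPoly_self_ne_zero {μ : ℕ → ℝ} {n i : ℕ}
    (hμ : Set.InjOn μ (Set.Iio n)) (hi : i < n) : (newtonPoly μ i).eval (μ i) ≠ 0 := by
  rw [eval_newtonPoly, Finset.prod_ne_zero_iff]
  intro j hj h
  have hji := Finset.mem_range.1 hj
  have := hμ (show i ∈ Set.Iio n from hi) (show j ∈ Set.Iio n from hji.trans hi)
    (sub_eq_zero.1 h)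
  omega

section Krylov

variable {n : ℕ} [NeZero n] (Y : Matrix (Fin n) (Fin n) ℝ) (s : ℕ → ℝ)
  (hY : ∀ i j : Fin n, (i : ℕ) + 1 < j → Y i j = 0)
  (hs : ∀ i j : Fin n, (j : ℕ) = i + 1 → Y i j = s i)
include hY

/-- Multiplication by a lower Hessenberg matrix moves the support of a row by at most one position
to the right. -/
theorem row_newtonPoly_eq_zero (μ : ℕ → ℝ) (p : ℕ) (l : Fin n) (hl : p < l) :
    (aeval Y (newtonPoly μ p)) 0 l = 0 := by
  induction p generalizing l with
  | zero =>
    have : (0 : Fin n) ≠ l := by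
      intro h
      simp [← h] at hl
    simp [newtonPoly, Matrix.one_apply_ne this]
  | succ p ih =>
    rw [newtonPoly_succ, map_mul, map_sub, aeval_X, aeval_C, mul_sub, Matrix.sub_apply,
      Matrix.mul_apply, Algebra.algebraMap_eq_smul_one, mul_smul_comm, mul_one,
      Matrix.smul_apply, ih l (by omega), smul_zero, sub_zero]
    refine Finset.sum_eq_zero fun i _ => ?_
    by_cases hi : p < i
    · rw [ih i hi, zero_mul]
    · rw [hY i l (by omega), mul_zero]

include hs

theorem row_newtonPoly_self (μ : ℕ → ℝ) (p : ℕ) (l : Fin n) (hl : (l : ℕ) = p) :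
    (aeval Y (newtonPoly μ p)) 0 l = ∏ j ∈ Finset.range p, s j := by
  induction p generalizing l with
  | zero =>
    have : l = 0 := Fin.ext (by simpa using hl)
    simp [newtonPoly, this]
  | succ p ih =>
    rw [newtonPoly_succ, map_mul, map_sub, aeval_X, aeval_C, mul_sub, Matrix.sub_apply,
      Matrix.mul_apply, Algebra.algebraMap_eq_smul_one, mul_smul_comm, mul_one,
      Matrix.smul_apply, row_newtonPoly_eq_zero Y hY μ p l (by omega), smul_zero, sub_zero,
      Finset.sum_eq_single (⟨p, by omega⟩ : Fin n), ih _ rfl, hs _ _ hl, Finset.prod_range_succ]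
    · intro i _ hi
      have hip : (i : ℕ) ≠ p := fun h => hi (Fin.ext h)
      by_cases hi' : p < i
      · rw [row_newtonPoly_eq_zero Y hY μ p i hi', zero_mul]
      · rw [hY i l (by omega), mul_zero]
    · simp

theorem det_row_newtonPoly (μ : ℕ → ℝ) {k : ℕ} (hk : k ≤ n) :
    (Matrix.of fun p l : Fin k => (aeval Y (newtonPoly μ p)) 0 (Fin.castLE hk l)).det
      = ∏ p ∈ Finset.range k, ∏ j ∈ Finset.range p, s j := by
  have h : Matrix.IsLowerTriangular
      (Matrix.of fun p l : Fin k => (aeval Y (newtonPoly μ p)) 0 (Fin.castLE hk l)) :=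
    fun p l (hpl : p < l) => row_newtonPoly_eq_zero Y hY μ p (Fin.castLE hk l) hpl
  rw [Matrix.det_of_isLowerTriangular _ h]
  simp only [Matrix.of_apply]
  rw [← Fin.prod_univ_eq_prod_range (fun p => ∏ j ∈ Finset.range p, s j) k]
  exact Finset.prod_congr rfl fun p _ => row_newtonPoly_self Y s hY hs μ p _ rfl

end Krylov

theorem aeval_transpose {n : ℕ} (Y : Matrix (Fin n) (Fin n) ℝ) (p : ℝ[X]) :
    aeval Yᵀ p = (aeval Y p)ᵀ := by
  induction p using Polynomial.induction_on' with
  | add p q hp hq => simp [hp, hq]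
  | monomial m r =>
    simp [aeval_monomial, Algebra.algebraMap_eq_smul_one, Matrix.transpose_pow]

/-- The product `b 1 ⋯ b p`. -/
noncomputable def subProd (b : ℕ → ℝ) (p : ℕ) : ℝ := ∏ j ∈ Finset.range p, b (j + 1)

/-- The Gram matrix of the Newton polynomials under `p ↦ p(Y)₀₀` is a product of two triangular
matrices, made of the first rows and of the first columns of the matrices `newtonPoly μ p (Y)`. -/
theorem det_moment_newtonPoly {n : ℕ} [NeZero n] (a b μ : ℕ → ℝ) {k : ℕ} (hk : k ≤ n) :
    (Matrix.of fun p q : Fin k =>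
      (aeval (hessenberg n a b) (newtonPoly μ p * newtonPoly μ q)) 0 0).det
      = ∏ p ∈ Finset.range k, subProd b p := by
  set Y := hessenberg n a b with hYdef
  have hY : ∀ i j : Fin n, (i : ℕ) + 1 < j → Y i j = 0 := by
    intro i j h
    simp only [hYdef, hessenberg, Matrix.of_apply]
    rw [if_neg (by omega), if_neg (by omega), if_neg (by omega)]
  have hYs : ∀ i j : Fin n, (j : ℕ) = i + 1 → Y i j = 1 := by
    intro i j h
    simp only [hYdef, hessenberg, Matrix.of_apply]
    rw [if_neg (by omega), if_pos h]
  have hT : ∀ i j : Fin n, (i : ℕ) + 1 < j → Yᵀ i j = 0 := by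
    intro i j h
    simp only [hYdef, hessenberg, Matrix.of_apply, Matrix.transpose_apply]
    rw [if_neg (by omega), if_neg (by omega), if_neg (by omega)]
  have hTs : ∀ i j : Fin n, (j : ℕ) = i + 1 → Yᵀ i j = b (i + 1) := by
    intro i j h
    simp only [hYdef, hessenberg, Matrix.of_apply, Matrix.transpose_apply]
    rw [if_neg (by omega), if_neg (by omega), if_pos h]
  have hfac : (Matrix.of fun p q : Fin k => (aeval Y (newtonPoly μ p * newtonPoly μ q)) 0 0)
      = (Matrix.of fun p l : Fin k => (aeval Y (newtonPoly μ p)) 0 (Fin.castLE hk l)) *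
        (Matrix.of fun q l : Fin k => (aeval Yᵀ (newtonPoly μ q)) 0 (Fin.castLE hk l))ᵀ := by
    ext p q
    rw [Matrix.of_apply, map_mul, Matrix.mul_apply, Matrix.mul_apply]
    symm
    refine Fintype.sum_of_injective (Fin.castLE hk) (Fin.castLE_injective hk) _ _ ?_ ?_
    · intro i hi
      have : k ≤ i := by
        by_contra h
        exact hi ⟨⟨i, not_le.1 h⟩, rfl⟩
      rw [row_newtonPoly_eq_zero Y hY μ p i (by omega), zero_mul]
    · intro i
      simp [aeval_transpose]
  rw [hfac, Matrix.det_mul, Matrix.det_transpose, det_row_newtonPoly Y (fun _ => 1) hY hYs μ hk,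
    det_row_newtonPoly Yᵀ (fun m => b (m + 1)) hT hTs μ hk]
  simp [subProd]

/-! ### The Lax equation for polynomials of a matrix -/

theorem hasDerivAt_lie_mul {n : ℕ} {M N : ℝ → Matrix (Fin n) (Fin n) ℝ}
    {B : Matrix (Fin n) (Fin n) ℝ} {t : ℝ}
    (hM : ∀ i j, HasDerivAt (fun s => M s i j) (⁅M t, B⁆ i j) t)
    (hN : ∀ i j, HasDerivAt (fun s => N s i j) (⁅N t, B⁆ i j) t) (i j : Fin n) :
    HasDerivAt (fun s => (M s * N s) i j) (⁅M t * N t, B⁆ i j) t := by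
  have h : HasDerivAt (fun s => ∑ l, M s i l * N s l j)
      (∑ l, (⁅M t, B⁆ i l * N t l j + M t i l * ⁅N t, B⁆ l j)) t :=
    HasDerivAt.fun_sum fun l _ => (hM i l).mul (hN l j)
  simp only [Matrix.mul_apply (M := M _)]
  have hlie : ⁅M t * N t, B⁆ = ⁅M t, B⁆ * N t + M t * ⁅N t, B⁆ := by
    simp only [Ring.lie_def, sub_mul, mul_sub, mul_assoc]
    abel
  rwa [Finset.sum_add_distrib, ← Matrix.mul_apply, ← Matrix.mul_apply, ← Matrix.add_apply,
    ← hlie] at h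

theorem hasDerivAt_lie_aeval {n : ℕ} {M : ℝ → Matrix (Fin n) (Fin n) ℝ}
    {B : Matrix (Fin n) (Fin n) ℝ} {t : ℝ}
    (hM : ∀ i j, HasDerivAt (fun s => M s i j) (⁅M t, B⁆ i j) t) (p : ℝ[X]) (i j : Fin n) :
    HasDerivAt (fun s => aeval (M s) p i j) (⁅aeval (M t) p, B⁆ i j) t := by
  induction p using Polynomial.induction_on generalizing i j with
  | C r =>
    simp only [aeval_C]
    rw [(Algebra.commute_algebraMap_left r B).lie_eq, Matrix.zero_apply]
    exact hasDerivAt_const t _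
  | add p q hp hq =>
    have hlie : ⁅aeval (M t) (p + q), B⁆ = ⁅aeval (M t) p, B⁆ + ⁅aeval (M t) q, B⁆ := by
      simp only [map_add, Ring.lie_def, add_mul, mul_add]
      abel
    rw [hlie]
    simp only [map_add]
    exact (hp i j).add (hq i j)
  | monomial m r ih =>
    simp only [pow_succ, ← mul_assoc, map_mul (aeval _) _ X, aeval_X]
    exact hasDerivAt_lie_mul ih hM i j

theorem meromorphicAt_aeval_apply {n : ℕ} {M : ℝ → Matrix (Fin n) (Fin n) ℝ} {t : ℝ}
    (hM : ∀ i j, MeromorphicAt (fun s => M s i j) t) (p : ℝ[X]) (i j : Fin n) :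
    MeromorphicAt (fun s => aeval (M s) p i j) t := by
  induction p using Polynomial.induction_on generalizing i j with
  | C r =>
    simp only [aeval_C]
    exact MeromorphicAt.const _ t
  | add p q hp hq =>
    simp only [map_add, Matrix.add_apply]
    exact (hp i j).add (hq i j)
  | monomial m r ih =>
    simp only [pow_succ, ← mul_assoc, map_mul (aeval _) _ X, aeval_X, Matrix.mul_apply]
    exact MeromorphicAt.fun_sum fun l _ => (ih i l).mul (hM l j)

/-! ### Unique continuation -/

/-- Near `t`, a function with `y' = O(y)` vanishes identically or nowhere: by Grönwall's inequality,
forwards and backwards in time, a single zero in a small interval spreads over all of it. -/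
theorem eventually_eq_zero_or_ne_zero_of_norm_deriv_le {E : Type*} [NormedAddCommGroup E]
    [NormedSpace ℝ E] {y y' : ℝ → E} {K t : ℝ}
    (h : ∀ᶠ s in 𝓝 t, HasDerivAt y (y' s) s ∧ ‖y' s‖ ≤ K * ‖y s‖) :
    (∀ᶠ s in 𝓝 t, y s = 0) ∨ ∀ᶠ s in 𝓝 t, y s ≠ 0 := by
  obtain ⟨ε, hε, hball⟩ := Metric.eventually_nhds_iff_ball.1 h
  by_cases hz : ∃ u ∈ Metric.ball t ε, y u = 0
  · left
    obtain ⟨u, hu, hu0⟩ := hz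
    refine Metric.eventually_nhds_iff_ball.2 ⟨ε, hε, fun s hs => ?_⟩
    rw [Real.ball_eq_Ioo] at hu hs hball
    have hsub : ∀ {c d : ℝ}, c ∈ Set.Ioo (t - ε) (t + ε) → d ∈ Set.Ioo (t - ε) (t + ε) →
        Set.Icc c d ⊆ Set.Ioo (t - ε) (t + ε) := fun hc hd => Set.Icc_subset_Ioo hc.1 hd.2
    rcases le_total u s with hus | hsu
    · refine eq_zero_of_abs_deriv_le_mul_abs_self_of_eq_zero_right (f := y) (f' := y') (K := K)
        (a := u) (b := s) ?_ ?_ hu0 ?_ s ⟨hus, le_rfl⟩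
      · exact fun x hx => (hball x (hsub hu hs hx)).1.continuousAt.continuousWithinAt
      · exact fun x hx => (hball x (hsub hu hs (Set.Ico_subset_Icc_self hx))).1.hasDerivWithinAt
      · exact fun x hx => (hball x (hsub hu hs (Set.Ico_subset_Icc_self hx))).2
    · -- time reversal turns the backward problem into a forward one
      have key : ∀ x ∈ Set.Icc (-u) (-s), -x ∈ Set.Ioo (t - ε) (t + ε) := fun x hx =>
        hsub hs hu ⟨by linarith [hx.2], by linarith [hx.1]⟩
      have hder : ∀ x ∈ Set.Icc (-u) (-s), HasDerivAt (fun x => y (-x)) (-y' (-x)) x := by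
        intro x hx
        have := (hball _ (key x hx)).1.scomp x (hasDerivAt_neg x)
        rwa [neg_one_smul] at this
      have := eq_zero_of_abs_deriv_le_mul_abs_self_of_eq_zero_right (f := fun x => y (-x))
        (f' := fun x => -y' (-x)) (K := K) (a := -u) (b := -s)
        (fun x hx => (hder x hx).continuousAt.continuousWithinAt)
        (fun x hx => (hder x (Set.Ico_subset_Icc_self hx)).hasDerivWithinAt) (by simpa using hu0)
        (fun x hx => by
          simpa using (hball _ (key x (Set.Ico_subset_Icc_self hx))).2) (-s)
        ⟨by linarith, le_rfl⟩
      simpa using this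
  · right
    push Not at hz
    exact Metric.eventually_nhds_iff_ball.2 ⟨ε, hε, hz⟩

/-- If near every point of the line a property holds identically or fails identically, the point
itself excepted, then it holds near every point as soon as it does near one. -/
theorem eventually_punctured_of_dichotomy {p : ℝ → Prop}
    (h : ∀ t, (∀ᶠ s in 𝓝[≠] t, p s) ∨ ∀ᶠ s in 𝓝[≠] t, ¬ p s) {t₀ : ℝ}
    (h₀ : ∀ᶠ s in 𝓝[≠] t₀, p s) (t : ℝ) : ∀ᶠ s in 𝓝[≠] t, p s := by
  have hopen : ∀ q : ℝ → Prop, IsOpen {t | ∀ᶠ s in 𝓝[≠] t, q s} := by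
    intro q
    refine isOpen_iff_mem_nhds.2 fun t ht => ?_
    have h1 : ∀ᶠ u in 𝓝[≠] t, ∀ᶠ s in 𝓝[≠] u, q s := by
      filter_upwards [eventually_nhdsWithin_of_eventually_nhds
        (eventually_eventually_nhds.2 (eventually_nhdsWithin_iff.1 ht)), self_mem_nhdsWithin]
        with u hu hut
      have h2 : ∀ᶠ s in 𝓝 u, s ≠ t := isOpen_ne.mem_nhds hut
      exact eventually_nhdsWithin_of_eventually_nhds ((hu.and h2).mono fun s hs => hs.1 hs.2)
    rw [eventually_nhdsWithin_iff] at h1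
    filter_upwards [h1] with u hu
    by_cases hut : u = t
    · exact hut ▸ ht
    · exact hu hut
  have hcompl : {t | ∀ᶠ s in 𝓝[≠] t, p s}ᶜ = {t | ∀ᶠ s in 𝓝[≠] t, ¬ p s} := by
    ext t
    constructor
    · exact fun ht => (h t).resolve_left ht
    · intro (ht : ∀ᶠ s in 𝓝[≠] t, ¬ p s) (ht' : ∀ᶠ s in 𝓝[≠] t, p s)
      obtain ⟨s, hs, hs'⟩ := (ht.and ht').exists
      exact hs hs'
  have hclopen : IsClopen {t | ∀ᶠ s in 𝓝[≠] t, p s} :=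
    ⟨⟨hcompl ▸ hopen _⟩, hopen _⟩
  have := hclopen.eq_univ ⟨t₀, h₀⟩
  exact (this ▸ Set.mem_univ t : t ∈ {t | ∀ᶠ s in 𝓝[≠] t, p s})

theorem eventually_pi_eq_zero_or_ne_zero_of_meromorphicAt {ι : Type*} [Finite ι] {y : ℝ → ι → ℝ}
    {t : ℝ} (h : ∀ i, MeromorphicAt (fun s => y s i) t) :
    (∀ᶠ s in 𝓝[≠] t, y s = 0) ∨ ∀ᶠ s in 𝓝[≠] t, y s ≠ 0 := by
  by_cases hall : ∀ i, ∀ᶠ s in 𝓝[≠] t, y s i = 0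
  · left
    filter_upwards [eventually_all.2 hall] with s hs
    exact funext hs
  · right
    push Not at hall
    obtain ⟨i, hi⟩ := hall
    have := (h i).eventually_eq_zero_or_eventually_ne_zero.resolve_left (by simpa using hi)
    exact this.mono fun s hs h0 => hs (by simp [h0])

/-! ### Regular times and poles -/

section Flow

variable {n : ℕ} {a b : ℕ → ℝ → ℝ}

theorem TodaRegularAt.continuousAt {t : ℝ} (h : TodaRegularAt n a b t) (i j : Fin n) :
    ContinuousAt (fun s => todaMatrix n a b s i j) t :=
  (h i j).continuousAt

theorem TodaRegularAt.exists_bound {t : ℝ} (h : TodaRegularAt n a b t) :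
    ∃ C, 0 ≤ C ∧ ∀ᶠ s in 𝓝 t, ∀ i j, |todaMatrix n a b s i j| ≤ C := by
  have hc : ContinuousAt (fun s => ∑ i, ∑ j, |todaMatrix n a b s i j|) t :=
    tendsto_finsetSum _ fun i _ => tendsto_finsetSum _ fun j _ => (h.continuousAt i j).abs
  refine ⟨(∑ i, ∑ j, |todaMatrix n a b t i j|) + 1, by positivity, ?_⟩
  filter_upwards [hc.eventually_lt_const (lt_add_one _)] with s hs i j
  refine le_trans ?_ hs.le
  refine le_trans ?_ (Finset.single_le_sum (f := fun i => ∑ j, |todaMatrix n a b s i j|)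
    (fun i _ => Finset.sum_nonneg fun j _ => abs_nonneg _) (Finset.mem_univ i))
  exact Finset.single_le_sum (f := fun j => |todaMatrix n a b s i j|)
    (fun j _ => abs_nonneg _) (Finset.mem_univ j)

theorem IsTodaFlow.regularAt_of_bounded (hflow : IsTodaFlow n a b) {t : ℝ}
    (h : ∀ i j, ∃ C, ∃ᶠ s in 𝓝[≠] t, |todaMatrix n a b s i j| ≤ C) : TodaRegularAt n a b t := by
  refine (hflow t).resolve_right ?_
  rintro ⟨-, i, j, hij⟩
  obtain ⟨C, hC⟩ := h i j
  exact hC ((hij.eventually_gt_atTop C).mono fun s hs => not_le.2 hs)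

theorem IsTodaFlow.eventually_regularAt (hflow : IsTodaFlow n a b) {t : ℝ}
    (h : TodaRegularAt n a b t) : ∀ᶠ s in 𝓝 t, TodaRegularAt n a b s := by
  obtain ⟨C, -, hC⟩ := h.exists_bound
  filter_upwards [eventually_eventually_nhds.2 hC] with u hu
  refine hflow.regularAt_of_bounded fun i j => ⟨C, ?_⟩
  exact (eventually_nhdsWithin_of_eventually_nhds (hu.mono fun s hs => hs i j)).frequently

theorem IsTodaFlow.eventually_regularAt_punctured (hflow : IsTodaFlow n a b) (t : ℝ) :
    ∀ᶠ s in 𝓝[≠] t, TodaRegularAt n a b s := by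
  rcases hflow t with h | h
  · exact eventually_nhdsWithin_of_eventually_nhds (hflow.eventually_regularAt h)
  · have han : ∀ᶠ u in 𝓝[≠] t, ∀ i j, AnalyticAt ℝ (fun s => todaMatrix n a b s i j) u :=
      eventually_all.2 fun i => eventually_all.2 fun j => (h.1 i j).eventually_analyticAt
    filter_upwards [han] with u hu
    refine hflow.regularAt_of_bounded fun i j => ⟨|todaMatrix n a b u i j| + 1, ?_⟩
    have := (hu i j).continuousAt.abs.eventually_le_const (lt_add_one _)
    exact (eventually_nhdsWithin_of_eventually_nhds this).frequently

theorem TodaRegularAt.hasDerivAt_aeval {t : ℝ} (h : TodaRegularAt n a b t) (p : ℝ[X])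
    (i j : Fin n) : HasDerivAt (fun s => aeval (todaMatrix n a b s) p i j)
      (⁅aeval (todaMatrix n a b t) p, strictLower (todaMatrix n a b t)⁆ i j) t :=
  hasDerivAt_lie_aeval h p i j

variable [NeZero n]

theorem lie_strictLower_row_zero (P M : Matrix (Fin n) (Fin n) ℝ) (j : Fin n) :
    ⁅P, strictLower M⁆ 0 j = ∑ l, P 0 l * strictLower M l j := by
  have : (strictLower M * P) 0 j = 0 := by
    rw [Matrix.mul_apply]
    refine Finset.sum_eq_zero fun l _ => ?_
    simp [strictLower]
  rw [Ring.lie_def, Matrix.sub_apply, this, sub_zero, Matrix.mul_apply]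

theorem lie_strictLower_zero_zero (P M : Matrix (Fin n) (Fin n) ℝ) :
    ⁅P, strictLower M⁆ 0 0 = (P * M) 0 0 - P 0 0 * M 0 0 := by
  rw [lie_strictLower_row_zero, Matrix.mul_apply, eq_sub_iff_add_eq,
    ← Finset.sum_erase_add _ _ (Finset.mem_univ (0 : Fin n)),
    ← Finset.sum_erase_add Finset.univ (fun l => P 0 l * M l 0) (Finset.mem_univ (0 : Fin n))]
  congr 1
  rw [add_eq_left.2 (by simp [strictLower])]
  refine Finset.sum_congr rfl fun l hl => ?_
  have : (0 : Fin n) < l := Fin.pos_iff_ne_zero.2 (Finset.ne_of_mem_erase hl)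
  simp [strictLower, this]

/-- The moments `p ↦ p(X)₀₀` evolve by the multiplication by `X`, up to a normalization. -/
theorem TodaRegularAt.hasDerivAt_moment {t : ℝ} (h : TodaRegularAt n a b t) (p : ℝ[X]) :
    HasDerivAt (fun s => aeval (todaMatrix n a b s) p 0 0)
      (aeval (todaMatrix n a b t) (p * X) 0 0
        - aeval (todaMatrix n a b t) p 0 0 * aeval (todaMatrix n a b t) (X : ℝ[X]) 0 0) t := by
  rw [map_mul, aeval_X, ← lie_strictLower_zero_zero]
  exact h.hasDerivAt_aeval p 0 0

/-! ### The spectrum is preserved -/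

/-- If `Q` annihilates the matrix at time `0`, then the first row of `Q(X(s))` vanishes for all `s`
near any time `t`, except perhaps at `t`: this row solves a homogeneous linear equation at regular
times and is meromorphic at poles. -/
theorem IsTodaFlow.row_aeval_eq_zero (hflow : IsTodaFlow n a b) (h0 : TodaRegularAt n a b 0)
    {Q : ℝ[X]} (hQ : aeval (todaMatrix n a b 0) Q = 0) (t : ℝ) :
    ∀ᶠ s in 𝓝[≠] t, (aeval (todaMatrix n a b s) Q) 0 = 0 := by
  have hreg : ∀ t, TodaRegularAt n a b t →
      (∀ᶠ s in 𝓝 t, (aeval (todaMatrix n a b s) Q) 0 = 0) ∨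
        ∀ᶠ s in 𝓝 t, (aeval (todaMatrix n a b s) Q) 0 ≠ 0 := by
    intro t ht
    obtain ⟨C, hC0, hC⟩ := ht.exists_bound
    refine eventually_eq_zero_or_ne_zero_of_norm_deriv_le (K := n * C)
      (y' := fun s j => ⁅aeval (todaMatrix n a b s) Q, strictLower (todaMatrix n a b s)⁆ 0 j) ?_
    filter_upwards [hflow.eventually_regularAt ht, hC] with s hs hsC
    refine ⟨hasDerivAt_pi.2 fun j => hs.hasDerivAt_aeval Q 0 j, ?_⟩
    refine (pi_norm_le_iff_of_nonneg (by positivity)).2 fun j => ?_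
    rw [lie_strictLower_row_zero]
    refine (norm_sum_le _ _).trans ?_
    have : ∀ l ∈ (Finset.univ : Finset (Fin n)),
        ‖aeval (todaMatrix n a b s) Q 0 l * strictLower (todaMatrix n a b s) l j‖
          ≤ C * ‖(aeval (todaMatrix n a b s) Q) 0‖ := by
      intro l _
      rw [norm_mul, mul_comm]
      refine mul_le_mul ?_ (norm_le_pi_norm _ l) (norm_nonneg _) hC0
      rw [Real.norm_eq_abs]
      by_cases hjl : j < l
      · simpa [strictLower, hjl] using hsC l j
      · simpa [strictLower, hjl] using hC0
    refine (Finset.sum_le_card_nsmul _ _ _ this).trans ?_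
    simp [mul_assoc]
  refine eventually_punctured_of_dichotomy (t₀ := 0) (fun t => ?_) ?_ t
  · rcases hflow t with ht | ht
    · exact (hreg t ht).imp eventually_nhdsWithin_of_eventually_nhds
        eventually_nhdsWithin_of_eventually_nhds
    · exact eventually_pi_eq_zero_or_ne_zero_of_meromorphicAt
        fun j => meromorphicAt_aeval_apply ht.1 Q 0 j
  · refine eventually_nhdsWithin_of_eventually_nhds ((hreg 0 h0).resolve_right fun h => ?_)
    exact h.self_of_nhds (by rw [hQ]; rfl)

end Flow

/-! ### Spectral weights -/

open Lagrange in
/-- Modulo the nodal polynomial of `S`, a polynomial is the combination of the Lagrange basis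
polynomials with its values on `S` as coefficients. -/
theorem nodal_dvd_sub_sum_basis (S : Finset ℝ) (p : ℝ[X]) :
    nodal S id ∣ p - ∑ x ∈ S, C (p.eval x) * Lagrange.basis S id x := by
  refine Finset.prod_dvd_of_coprime
    (fun x _ y _ hxy => pairwise_coprime_X_sub_C Function.injective_id hxy) fun x hx => ?_
  rw [dvd_iff_isRoot, IsRoot, eval_sub, eval_finsetSum, Finset.sum_eq_single x]
  · have := eval_basis_self (Function.injective_id.injOn (s := (S : Set ℝ))) hx
    simp only [id] at this
    simp [this]
  · intro y _ hyx
    have := eval_basis_of_ne (v := (id : ℝ → ℝ)) hyx hx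
    simp only [id] at this
    simp [this]
  · exact fun h => absurd hx h

/-- The weight of `x ∈ S` in the spectral measure `p ↦ p(M)₀₀` of a matrix with spectrum `S`. -/
noncomputable def spectralWeight {n : ℕ} [NeZero n] (S : Finset ℝ)
    (M : Matrix (Fin n) (Fin n) ℝ) (x : ℝ) : ℝ :=
  aeval M (Lagrange.basis S id x) 0 0

theorem moment_eq_sum_spectralWeight {n : ℕ} [NeZero n] {S : Finset ℝ}
    {M : Matrix (Fin n) (Fin n) ℝ} (hM : aeval M (Lagrange.nodal S id) 0 = 0) (p : ℝ[X]) :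
    aeval M p 0 0 = ∑ x ∈ S, p.eval x * spectralWeight S M x := by
  obtain ⟨h, hh⟩ := nodal_dvd_sub_sum_basis S p
  have h0 : aeval M (Lagrange.nodal S id * h) 0 0 = 0 := by
    rw [map_mul, Matrix.mul_apply]
    exact Finset.sum_eq_zero fun l _ => by rw [hM]; simp
  rw [← hh, map_sub, Matrix.sub_apply, sub_eq_zero] at h0
  rw [h0, map_sum, Matrix.sum_apply]
  refine Finset.sum_congr rfl fun x _ => ?_
  rw [map_mul, aeval_C, Algebra.algebraMap_eq_smul_one, smul_mul_assoc, one_mul,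
    Matrix.smul_apply, smul_eq_mul, spectralWeight]

section Flow

variable {n : ℕ} [NeZero n] {a b : ℕ → ℝ → ℝ}

theorem TodaRegularAt.hasDerivAt_spectralWeight {t : ℝ} (h : TodaRegularAt n a b t)
    {S : Finset ℝ} (hS : aeval (todaMatrix n a b t) (Lagrange.nodal S id) 0 = 0) {x : ℝ}
    (hx : x ∈ S) :
    HasDerivAt (fun s => spectralWeight S (todaMatrix n a b s) x)
      (x * spectralWeight S (todaMatrix n a b t) x - spectralWeight S (todaMatrix n a b t) x *
        ∑ y ∈ S, y * spectralWeight S (todaMatrix n a b t) y) t := by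
  have h1 := h.hasDerivAt_moment (Lagrange.basis S id x)
  rw [moment_eq_sum_spectralWeight hS (_ * X), moment_eq_sum_spectralWeight hS X,
    Finset.sum_eq_single x] at h1
  · have := Lagrange.eval_basis_self (Function.injective_id.injOn (s := (S : Set ℝ))) hx
    simp only [id] at this
    simpa [this, spectralWeight] using h1
  · intro y hy hyx
    have := Lagrange.eval_basis_of_ne (v := (id : ℝ → ℝ)) hyx.symm hy
    simp only [id] at this
    simp [this]
  · exact fun h => absurd hx h

/-- The function `∑ x ∈ S, c x * exp (x * t)`. -/
noncomputable def expSum (S : Finset ℝ) (c : ℝ → ℝ) (t : ℝ) : ℝ :=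
  ∑ x ∈ S, c x * Real.exp (x * t)

theorem hasDerivAt_mul_exp (c x t : ℝ) :
    HasDerivAt (fun s => c * Real.exp (x * s)) (x * (c * Real.exp (x * t))) t := by
  have h1 : HasDerivAt (fun s => x * s) x t := by simpa using (hasDerivAt_id t).const_mul x
  exact (h1.exp.const_mul c).congr_deriv (by ring)

theorem hasDerivAt_expSum (S : Finset ℝ) (c : ℝ → ℝ) (t : ℝ) :
    HasDerivAt (expSum S c) (∑ x ∈ S, x * (c x * Real.exp (x * t))) t :=
  HasDerivAt.fun_sum fun x _ => hasDerivAt_mul_exp (c x) x t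

/-- The defect of the formula `w x (t) = c x * exp (x * t) / ∑ y, c y * exp (y * t)` for the
spectral weights, cleared of denominators. -/
noncomputable def weightDefect (n : ℕ) [NeZero n] (a b : ℕ → ℝ → ℝ) (S : Finset ℝ) (c : ℝ → ℝ)
    (t : ℝ) (x : S) : ℝ :=
  spectralWeight S (todaMatrix n a b t) x * expSum S c t - c x * Real.exp (x * t)

theorem sum_mul_weightDefect (S : Finset ℝ) (c : ℝ → ℝ) (t : ℝ) :
    ∑ y : S, (y : ℝ) * weightDefect n a b S c t y
      = (∑ y ∈ S, y * spectralWeight S (todaMatrix n a b t) y) * expSum S c t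
        - ∑ y ∈ S, y * (c y * Real.exp (y * t)) := by
  rw [Finset.sum_mul, ← Finset.sum_sub_distrib, ← Finset.sum_coe_sort S]
  exact Finset.sum_congr rfl fun y _ => by rw [weightDefect]; ring

theorem TodaRegularAt.hasDerivAt_weightDefect {t : ℝ} (h : TodaRegularAt n a b t)
    {S : Finset ℝ} (hS : aeval (todaMatrix n a b t) (Lagrange.nodal S id) 0 = 0)
    (c : ℝ → ℝ) (x : S) :
    HasDerivAt (fun s => weightDefect n a b S c s x)
      (x * weightDefect n a b S c t x - spectralWeight S (todaMatrix n a b t) x *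
        ∑ y : S, (y : ℝ) * weightDefect n a b S c t y) t := by
  have h1 := ((h.hasDerivAt_spectralWeight hS x.2).mul (hasDerivAt_expSum S c t)).sub
    (hasDerivAt_mul_exp (c x) x t)
  refine h1.congr_deriv ?_
  rw [sum_mul_weightDefect, weightDefect]
  ring

theorem IsTodaFlow.weightDefect_eq_zero (hflow : IsTodaFlow n a b) (h0 : TodaRegularAt n a b 0)
    {S : Finset ℝ} (hS : aeval (todaMatrix n a b 0) (Lagrange.nodal S id) = 0) (t : ℝ) :
    ∀ᶠ s in 𝓝[≠] t,
      weightDefect n a b S (spectralWeight S (todaMatrix n a b 0)) s = 0 := by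
  set c := spectralWeight S (todaMatrix n a b 0) with hc
  have hrow := hflow.row_aeval_eq_zero h0 hS
  have hrow' : ∀ t, TodaRegularAt n a b t →
      aeval (todaMatrix n a b t) (Lagrange.nodal S id) 0 = 0 := by
    intro t ht
    funext j
    have h1 : Tendsto (fun s => aeval (todaMatrix n a b s) (Lagrange.nodal S id) 0 j) (𝓝[≠] t)
        (𝓝 (aeval (todaMatrix n a b t) (Lagrange.nodal S id) 0 j)) :=
      (ht.hasDerivAt_aeval _ 0 j).continuousAt.tendsto.mono_left nhdsWithin_le_nhds
    refine tendsto_nhds_unique h1 (tendsto_const_nhds.congr' ?_)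
    filter_upwards [hrow t] with s hs
    rw [hs]
  have hreg : ∀ t, TodaRegularAt n a b t →
      (∀ᶠ s in 𝓝 t, weightDefect n a b S c s = 0) ∨
        ∀ᶠ s in 𝓝 t, weightDefect n a b S c s ≠ 0 := by
    intro t ht
    obtain ⟨W, hW0, hW⟩ : ∃ W : ℝ, 0 ≤ W ∧ ∀ᶠ s in 𝓝 t, ∀ x ∈ S,
        |spectralWeight S (todaMatrix n a b s) x| ≤ W := by
      have hcont : ContinuousAt
          (fun s => ∑ x ∈ S, |spectralWeight S (todaMatrix n a b s) x|) t :=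
        tendsto_finsetSum _ fun x hx =>
          (ht.hasDerivAt_spectralWeight (hrow' t ht) hx).continuousAt.abs
      refine ⟨(∑ x ∈ S, |spectralWeight S (todaMatrix n a b t) x|) + 1, by positivity, ?_⟩
      filter_upwards [hcont.eventually_lt_const (lt_add_one _)] with s hs x hx
      exact (Finset.single_le_sum (f := fun x => |spectralWeight S (todaMatrix n a b s) x|)
        (fun x _ => abs_nonneg _) hx).trans hs.le
    set R : ℝ := ∑ y : S, |(y : ℝ)| with hR
    have hR0 : 0 ≤ R := Finset.sum_nonneg fun _ _ => abs_nonneg _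
    refine eventually_eq_zero_or_ne_zero_of_norm_deriv_le (K := R + W * R)
      (y' := fun s x => x * weightDefect n a b S c s x -
        spectralWeight S (todaMatrix n a b s) x *
          ∑ y : S, (y : ℝ) * weightDefect n a b S c s y) ?_
    filter_upwards [hflow.eventually_regularAt ht, hW] with s hs hsW
    refine ⟨hasDerivAt_pi.2 fun x => hs.hasDerivAt_weightDefect (hrow' s hs) c x, ?_⟩
    refine (pi_norm_le_iff_of_nonneg (by positivity)).2 fun x => ?_
    set D := weightDefect n a b S c s
    have hx : |(x : ℝ)| ≤ R :=
      Finset.single_le_sum (f := fun y : S => |(y : ℝ)|) (fun _ _ => abs_nonneg _)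
        (Finset.mem_univ x)
    have hsum : ‖∑ y : S, (y : ℝ) * D y‖ ≤ R * ‖D‖ := by
      rw [hR, Finset.sum_mul]
      refine (norm_sum_le _ _).trans (Finset.sum_le_sum fun y _ => ?_)
      rw [norm_mul]
      exact mul_le_mul_of_nonneg_left (norm_le_pi_norm D y) (abs_nonneg _)
    calc ‖(x : ℝ) * D x - spectralWeight S (todaMatrix n a b s) x * ∑ y : S, (y : ℝ) * D y‖
        ≤ ‖(x : ℝ) * D x‖ + ‖spectralWeight S (todaMatrix n a b s) x *
            ∑ y : S, (y : ℝ) * D y‖ := norm_sub_le _ _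
      _ ≤ R * ‖D‖ + W * (R * ‖D‖) := by
          rw [norm_mul, norm_mul]
          exact add_le_add (mul_le_mul hx (norm_le_pi_norm D x) (norm_nonneg _) hR0)
            (mul_le_mul (hsW x x.2) hsum (norm_nonneg _) hW0)
      _ = (R + W * R) * ‖D‖ := by ring
  refine eventually_punctured_of_dichotomy (t₀ := 0) (fun t => ?_) ?_ t
  · rcases hflow t with ht | ht
    · exact (hreg t ht).imp eventually_nhdsWithin_of_eventually_nhds
        eventually_nhdsWithin_of_eventually_nhds
    · refine eventually_pi_eq_zero_or_ne_zero_of_meromorphicAt fun x => ?_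
      have hexp : ∀ y d : ℝ, MeromorphicAt (fun s => d * Real.exp (y * s)) t := fun y d =>
        AnalyticAt.meromorphicAt (by fun_prop)
      exact ((meromorphicAt_aeval_apply ht.1 _ 0 0).mul
        (MeromorphicAt.fun_sum fun y _ => hexp y (c y))).sub (hexp x (c x))
  · refine eventually_nhdsWithin_of_eventually_nhds ((hreg 0 h0).resolve_right fun h => ?_)
    refine h.self_of_nhds (funext fun x => ?_)
    -- the initial weights have total mass one
    have hone := moment_eq_sum_spectralWeight (hrow' 0 h0) 1
    simp only [map_one, Matrix.one_apply_eq, eval_one, one_mul] at hone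
    rw [← hc] at hone
    simp [weightDefect, expSum, ← hc, ← hone]

/-- The moments of the matrix along a Toda flow: the spectral measure is the initial one with the
density `exp (x * t)`, up to normalization. -/
theorem IsTodaFlow.moment_mul_expSum (hflow : IsTodaFlow n a b) (h0 : TodaRegularAt n a b 0)
    {S : Finset ℝ} (hS : aeval (todaMatrix n a b 0) (Lagrange.nodal S id) = 0) (t : ℝ) :
    ∀ᶠ s in 𝓝[≠] t, ∀ p : ℝ[X],
      aeval (todaMatrix n a b s) p 0 0 * expSum S (spectralWeight S (todaMatrix n a b 0)) s
        = expSum S (fun x => p.eval x * spectralWeight S (todaMatrix n a b 0) x) s := by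
  filter_upwards [hflow.row_aeval_eq_zero h0 hS t, hflow.weightDefect_eq_zero h0 hS t]
    with s hs hD p
  rw [moment_eq_sum_spectralWeight hs, Finset.sum_mul]
  refine Finset.sum_congr rfl fun x hx => ?_
  have := congr_fun hD ⟨x, hx⟩
  simp only [weightDefect, Pi.zero_apply, sub_eq_zero] at this
  rw [mul_assoc, this, mul_assoc]

theorem TodaRegularAt.moment_mul_expSum {t : ℝ} (h : TodaRegularAt n a b t)
    (hflow : IsTodaFlow n a b) (h0 : TodaRegularAt n a b 0)
    {S : Finset ℝ} (hS : aeval (todaMatrix n a b 0) (Lagrange.nodal S id) = 0) (p : ℝ[X]) :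
    aeval (todaMatrix n a b t) p 0 0 * expSum S (spectralWeight S (todaMatrix n a b 0)) t
      = expSum S (fun x => p.eval x * spectralWeight S (todaMatrix n a b 0) x) t := by
  have h1 : Tendsto (fun s => aeval (todaMatrix n a b s) p 0 0 *
      expSum S (spectralWeight S (todaMatrix n a b 0)) s) (𝓝[≠] t) (𝓝 _) :=
    ((h.hasDerivAt_aeval p 0 0).continuousAt.mul
      (hasDerivAt_expSum S _ t).continuousAt).tendsto.mono_left nhdsWithin_le_nhds
  refine tendsto_nhds_unique h1 (Tendsto.congr' ?_
    ((hasDerivAt_expSum S _ t).continuousAt.tendsto.mono_left nhdsWithin_le_nhds))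
  filter_upwards [hflow.moment_mul_expSum h0 hS t] with s hs
  exact (hs p).symm

end Flow

/-! ### Gram determinants of exponential sums -/

/-- The Gram matrix of the first `k` Newton polynomials of `μ` for the measure on `S` with the
weight `c x * exp (x * t)` at `x`. -/
noncomputable def expGram (S : Finset ℝ) (c : ℝ → ℝ) (μ : ℕ → ℝ) (k : ℕ) (t : ℝ) :
    Matrix (Fin k) (Fin k) ℝ :=
  Matrix.of fun p q =>
    expSum S (fun x => (newtonPoly μ p * newtonPoly μ q).eval x * c x) t

theorem continuous_expSum (S : Finset ℝ) (c : ℝ → ℝ) : Continuous (expSum S c) :=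
  continuous_iff_continuousAt.2 fun t => (hasDerivAt_expSum S c t).continuousAt

theorem continuous_det_expGram (S : Finset ℝ) (c : ℝ → ℝ) (μ : ℕ → ℝ) (k : ℕ) :
    Continuous fun t => (expGram S c μ k t).det :=
  Continuous.matrix_det (continuous_matrix fun _ _ => continuous_expSum S _)

theorem expSum_image {n : ℕ} {μ : ℕ → ℝ} (hμ : Set.InjOn μ (Set.Iio n)) (d : ℝ → ℝ) (t : ℝ) :
    expSum ((Finset.range n).image μ) d t
      = ∑ i ∈ Finset.range n, d (μ i) * Real.exp (μ i * t) := by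
  rw [expSum, Finset.sum_image]
  simpa using hμ

theorem tendsto_exp_mul_expGram_apply {n : ℕ} {μ : ℕ → ℝ} {ε : ℝ}
    (hμ : Set.InjOn μ (Set.Iio n)) (hε : ∀ i j, i < j → j < n → ε * μ j < ε * μ i) (c : ℝ → ℝ)
    {k : ℕ} (hk : k ≤ n) (p q : Fin k) :
    Tendsto (fun t => Real.exp (-(ε * μ p) * t) *
        expGram ((Finset.range n).image μ) c μ k (ε * t) p q) atTop
      (𝓝 ((newtonPoly μ p).eval (μ p) * (newtonPoly μ q).eval (μ p) * c (μ p))) := by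
  have hpn : (p : ℕ) < n := p.2.trans_le hk
  have hterm : ∀ i ∈ Finset.range n, Tendsto (fun t => Real.exp (-(ε * μ p) * t) *
      ((newtonPoly μ p * newtonPoly μ q).eval (μ i) * c (μ i) * Real.exp (μ i * (ε * t)))) atTop
      (𝓝 (if i = p then
        (newtonPoly μ p).eval (μ p) * (newtonPoly μ q).eval (μ p) * c (μ p) else 0)) := by
    intro i hi
    have hin := Finset.mem_range.1 hi
    have hrew : ∀ t, Real.exp (-(ε * μ p) * t) *
        ((newtonPoly μ p * newtonPoly μ q).eval (μ i) * c (μ i) * Real.exp (μ i * (ε * t)))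
        = (newtonPoly μ p * newtonPoly μ q).eval (μ i) * c (μ i) *
          Real.exp ((ε * μ i - ε * μ p) * t) := by
      intro t
      rw [mul_left_comm, ← Real.exp_add]
      congr 2
      ring
    simp only [hrew]
    rcases lt_trichotomy i p with h | h | h
    · rw [if_neg h.ne]
      simp [eval_newtonPoly_of_lt μ h]
    · subst h
      simp
    · rw [if_neg h.ne']
      have h1 : Tendsto (fun t => (ε * μ i - ε * μ p) * t) atTop atBot :=
        tendsto_id.const_mul_atTop_of_neg (sub_neg.2 (hε p i h hin))
      simpa using (Real.tendsto_exp_atBot.comp h1).const_mul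
        ((newtonPoly μ p * newtonPoly μ q).eval (μ i) * c (μ i))
  have hsum := tendsto_finsetSum _ hterm
  rw [Finset.sum_ite_eq' (Finset.range n) (p : ℕ), if_pos (Finset.mem_range.2 hpn)] at hsum
  refine hsum.congr fun t => ?_
  rw [expGram, Matrix.of_apply, expSum_image hμ, Finset.mul_sum]

/-- After the rescaling of its rows by the leading exponentials, the Gram matrix has a triangular
limit, since the Newton polynomial of index `q` vanishes at `μ p` for `p < q`. -/
theorem tendsto_det_expGram {n : ℕ} {μ : ℕ → ℝ} {ε : ℝ}
    (hμ : Set.InjOn μ (Set.Iio n)) (hε : ∀ i j, i < j → j < n → ε * μ j < ε * μ i) (c : ℝ → ℝ)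
    {k : ℕ} (hk : k ≤ n) :
    Tendsto (fun t => (∏ p ∈ Finset.range k, Real.exp (-(ε * μ p) * t)) *
        (expGram ((Finset.range n).image μ) c μ k (ε * t)).det) atTop
      (𝓝 (∏ p ∈ Finset.range k, ((newtonPoly μ p).eval (μ p) ^ 2 * c (μ p)))) := by
  have hlim := tendsto_pi_nhds.2 fun p => tendsto_pi_nhds.2 fun q =>
    tendsto_exp_mul_expGram_apply hμ hε c hk p q
  have hdet := ((Continuous.matrix_det continuous_id).tendsto
    (Matrix.of fun p q : Fin k =>
      (newtonPoly μ p).eval (μ p) * (newtonPoly μ q).eval (μ p) * c (μ p))).comp hlim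
  have htri : Matrix.IsLowerTriangular (Matrix.of fun p q : Fin k =>
      (newtonPoly μ p).eval (μ p) * (newtonPoly μ q).eval (μ p) * c (μ p)) := by
    intro p q (hpq : p < q)
    simp [eval_newtonPoly_of_lt μ (show (p : ℕ) < q from hpq)]
  simp only [id] at hdet
  rw [Matrix.det_of_isLowerTriangular _ htri] at hdet
  rw [← Fin.prod_univ_eq_prod_range
    (fun p => (newtonPoly μ p).eval (μ p) ^ 2 * c (μ p)) k]
  simp only [Matrix.of_apply, ← sq] at hdet
  refine hdet.congr fun t => ?_
  rw [← Fin.prod_univ_eq_prod_range (fun p => Real.exp (-(ε * μ p) * t)) k]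
  exact Matrix.det_mul_column (fun p : Fin k => Real.exp (-(ε * μ p) * t)) _

theorem det_expGram_zero_of_weight_eq_zero {n : ℕ} {μ : ℕ → ℝ} (hμ : Set.InjOn μ (Set.Iio n))
    {c : ℝ → ℝ} {i : ℕ} (hi : i < n) (hc : c (μ i) = 0) (t : ℝ) :
    (expGram ((Finset.range n).image μ) c μ n t).det = 0 := by
  have hfac : expGram ((Finset.range n).image μ) c μ n t
      = (Matrix.of fun p j : Fin n => (newtonPoly μ p).eval (μ j) * c (μ j)) *
        (Matrix.of fun j q : Fin n => (newtonPoly μ q).eval (μ j) * Real.exp (μ j * t)) := by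
    ext p q
    rw [expGram, Matrix.of_apply, expSum_image hμ, Matrix.mul_apply,
      ← Fin.sum_univ_eq_sum_range (fun j => (newtonPoly μ p * newtonPoly μ q).eval (μ j) *
        c (μ j) * Real.exp (μ j * t))]
    refine Finset.sum_congr rfl fun j _ => ?_
    simp only [Matrix.of_apply, eval_mul]
    ring
  rw [hfac, Matrix.det_mul, Matrix.det_eq_zero_of_column_eq_zero ⟨i, hi⟩ (fun p => by simp [hc]),
    zero_mul]

/-- If the moments `p(M)₀₀` of a Hessenberg matrix are those of the measure with the weights
`c x * exp (x * t)`, divided by its mass, then the Gram determinants of this measure are the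
products of the subdiagonal products of the matrix. -/
theorem det_expGram_eq {n : ℕ} [NeZero n] {a b : ℕ → ℝ} {S : Finset ℝ} {c : ℝ → ℝ} {t : ℝ}
    (h : ∀ p : ℝ[X], aeval (hessenberg n a b) p 0 0 * expSum S c t
      = expSum S (fun x => p.eval x * c x) t) (μ : ℕ → ℝ) {k : ℕ} (hk : k ≤ n) :
    (expGram S c μ k t).det = ∏ p ∈ Finset.range k, (expSum S c t * subProd b p) := by
  have hsmul : expGram S c μ k t = expSum S c t • Matrix.of fun p q : Fin k =>
      (aeval (hessenberg n a b) (newtonPoly μ p * newtonPoly μ q)) 0 0 := by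
    ext p q
    rw [expGram, Matrix.of_apply, ← h, Matrix.smul_apply, Matrix.of_apply, smul_eq_mul, mul_comm]
  rw [hsmul, Matrix.det_smul, det_moment_newtonPoly a b μ hk, Fintype.card_fin,
    Finset.prod_mul_distrib, Finset.prod_const, Finset.card_range]

theorem subProd_succ (b : ℕ → ℝ) (p : ℕ) : subProd b (p + 1) = subProd b p * b (p + 1) :=
  Finset.prod_range_succ _ _

/-- The subdiagonal entries as ratios of Gram determinants: successive ratios of the determinants
are the products `b 1 ⋯ b p` times the mass of the measure, which cancels. -/
theorem subdiagonal_eq_of_det_expGram {n : ℕ} [NeZero n] {a b : ℕ → ℝ} {S : Finset ℝ} {c : ℝ → ℝ}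
    {t : ℝ} (h : ∀ p : ℝ[X], aeval (hessenberg n a b) p 0 0 * expSum S c t
      = expSum S (fun x => p.eval x * c x) t) (μ : ℕ → ℝ) {k : ℕ} (hk : k + 1 < n)
    (h1 : (expGram S c μ (k + 1) t).det ≠ 0) :
    b (k + 1) = ((expGram S c μ (k + 2) t).det / (expGram S c μ (k + 1) t).det) /
      ((expGram S c μ (k + 1) t).det / (expGram S c μ k t).det) := by
  rw [det_expGram_eq h μ hk.le, Finset.prod_range_succ] at h1
  obtain ⟨h2, h3⟩ := mul_ne_zero_iff.1 h1
  rw [det_expGram_eq h μ (show k + 2 ≤ n from hk), det_expGram_eq h μ hk.le,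
    det_expGram_eq h μ (show k ≤ n by omega),
    Finset.prod_range_succ (n := k + 1), Finset.prod_range_succ (n := k),
    mul_div_cancel_left₀ _ h1, mul_div_cancel_left₀ _ h2, subProd_succ]
  obtain ⟨h4, h5⟩ := mul_ne_zero_iff.1 h3
  field_simp

/-! ### Absence of poles at large times -/

section Flow

variable {n : ℕ} {a b : ℕ → ℝ → ℝ}

theorem todaMatrix_offDiag_bounded {l : Filter ℝ}
    (h : ∀ k, k + 1 < n → ∃ C, ∀ᶠ s in l, |b (k + 1) s| ≤ C) :
    ∃ C, 0 ≤ C ∧ ∀ᶠ s in l, ∀ i j : Fin n, i ≠ j → |todaMatrix n a b s i j| ≤ C := by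
  choose! C hC using h
  refine ⟨1 + ∑ k ∈ Finset.range n, |C k|, by positivity, ?_⟩
  have hall : ∀ᶠ s in l, ∀ k ∈ Finset.range n, k + 1 < n → |b (k + 1) s| ≤ C k :=
    (Finset.eventually_all _).2 fun k _ => by
      by_cases hk : k + 1 < n
      · exact (hC k hk).mono fun s hs _ => hs
      · exact Eventually.of_forall fun s h => absurd h hk
  filter_upwards [hall] with s hs i j hij
  have hnn : 0 ≤ ∑ k ∈ Finset.range n, |C k| := Finset.sum_nonneg fun _ _ => abs_nonneg _
  have hij' : (i : ℕ) ≠ j := fun h => hij (Fin.ext h)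
  simp only [todaMatrix, hessenberg, Matrix.of_apply, if_neg hij']
  split_ifs with h1 h2
  · simpa using hnn
  · have hj : (j : ℕ) ∈ Finset.range n := Finset.mem_range.2 j.2
    have h3 := hs j hj (by omega)
    have h4 := Finset.single_le_sum (f := fun k => |C k|) (fun _ _ => abs_nonneg _) hj
    linarith [le_abs_self (C j)]
  · rw [abs_zero]
    positivity

theorem abs_lie_strictLower_diag_le {M : Matrix (Fin n) (Fin n) ℝ} {C : ℝ} (hC : 0 ≤ C)
    (h : ∀ i j, i ≠ j → |M i j| ≤ C) (i : Fin n) :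
    |⁅M, strictLower M⁆ i i| ≤ 2 * (n * C ^ 2) := by
  have hB : ∀ i j, i ≠ j → |strictLower M i j| ≤ C := by
    intro i j hij
    by_cases hlt : j < i
    · simpa [strictLower, hlt] using h i j hij
    · simpa [strictLower, hlt] using hC
  have hB0 : strictLower M i i = 0 := by simp [strictLower]
  have hsum : ∀ F : Fin n → ℝ, (∀ l, |F l| ≤ C ^ 2) → |∑ l, F l| ≤ n * C ^ 2 := by
    intro F hF
    refine (Finset.abs_sum_le_sum_abs _ _).trans ?_
    refine (Finset.sum_le_card_nsmul _ _ _ fun l _ => hF l).trans ?_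
    simp
  rw [Ring.lie_def, Matrix.sub_apply, Matrix.mul_apply, Matrix.mul_apply, two_mul]
  refine (abs_sub _ _).trans (add_le_add (hsum _ fun l => ?_) (hsum _ fun l => ?_))
  · by_cases hl : l = i
    · subst hl
      rw [hB0, mul_zero, abs_zero]
      positivity
    · rw [abs_mul, sq]
      exact mul_le_mul (h _ _ (Ne.symm hl)) (hB _ _ hl) (abs_nonneg _) hC
  · by_cases hl : l = i
    · subst hl
      rw [hB0, zero_mul, abs_zero]
      positivity
    · rw [abs_mul, sq]
      exact mul_le_mul (hB _ _ (Ne.symm hl)) (h _ _ hl) (abs_nonneg _) hC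

/-- A time near which the subdiagonal is bounded is not a pole: there the derivatives of the
diagonal entries are bounded, hence so are the diagonal entries. -/
theorem IsTodaFlow.regularAt_of_subdiagonal_bounded (hflow : IsTodaFlow n a b) {u : ℝ}
    (h : ∀ k, k + 1 < n → ∃ C, ∀ᶠ s in 𝓝[≠] u, |b (k + 1) s| ≤ C) : TodaRegularAt n a b u := by
  obtain ⟨C, hC0, hC⟩ := todaMatrix_offDiag_bounded (a := a) h
  have hle : 𝓝[>] u ≤ 𝓝[≠] u := nhdsWithin_mono _ fun s hs => ne_of_gt hs
  refine hflow.regularAt_of_bounded fun i j => ?_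
  by_cases hij : i = j
  · subst hij
    obtain ⟨v, hv, hI⟩ := mem_nhdsGT_iff_exists_Ioo_subset.1
      (hle ((hflow.eventually_regularAt_punctured u).and hC))
    obtain ⟨w, hw⟩ := exists_between (Set.mem_Ioi.1 hv)
    refine ⟨|todaMatrix n a b w i i| + 2 * (n * C ^ 2) * (v - u), ?_⟩
    have hev : ∀ᶠ s in 𝓝[>] u,
        |todaMatrix n a b s i i| ≤ |todaMatrix n a b w i i| + 2 * (n * C ^ 2) * (v - u) := by
      filter_upwards [Ioo_mem_nhdsGT (Set.mem_Ioi.1 hv)] with s hs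
      have hmvt := (convex_Ioo u v).norm_image_sub_le_of_norm_hasDerivWithin_le
        (f := fun s => todaMatrix n a b s i i) (C := 2 * (n * C ^ 2))
        (fun x hx => ((hI hx).1 i i).hasDerivWithinAt)
        (fun x hx => abs_lie_strictLower_diag_le hC0 (hI hx).2 i) hw hs
      have h1 : ‖s - w‖ ≤ v - u := by
        rw [Real.norm_eq_abs, abs_le]
        constructor <;> linarith [hs.1, hs.2, hw.1, hw.2]
      have h2 := hmvt.trans (mul_le_mul_of_nonneg_left h1 (by positivity))
      have h3 := abs_sub_abs_le_abs_sub (todaMatrix n a b s i i) (todaMatrix n a b w i i)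
      rw [Real.norm_eq_abs] at h2
      linarith
    exact hev.frequently.filter_mono hle
  · exact ⟨C, (hC.mono fun s hs => hs i j hij).frequently⟩

variable [NeZero n]

theorem IsTodaFlow.regularAt_of_det_expGram_ne_zero (hflow : IsTodaFlow n a b)
    (h0 : TodaRegularAt n a b 0) {S : Finset ℝ}
    (hS : aeval (todaMatrix n a b 0) (Lagrange.nodal S id) = 0) (μ : ℕ → ℝ) {u : ℝ}
    (hu : ∀ k, k ≤ n → (expGram S (spectralWeight S (todaMatrix n a b 0)) μ k u).det ≠ 0) :
    TodaRegularAt n a b u := by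
  refine hflow.regularAt_of_subdiagonal_bounded fun k hk => ?_
  set c := spectralWeight S (todaMatrix n a b 0)
  have hcont := fun k => (continuous_det_expGram S c μ k).continuousAt (x := u)
  have hlim := (((hcont (k + 2)).div (hcont (k + 1)) (hu _ hk.le)).div
    ((hcont (k + 1)).div (hcont k) (hu _ (by omega)))
    (div_ne_zero (hu _ hk.le) (hu _ (by omega)))).abs.eventually_le_const (lt_add_one _)
  refine ⟨?C, ?_⟩
  rotate_left
  filter_upwards [hflow.moment_mul_expSum h0 hS u, eventually_nhdsWithin_of_eventually_nhds hlim,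
    eventually_nhdsWithin_of_eventually_nhds ((hcont (k + 1)).eventually_ne (hu _ hk.le))]
    with s hs hs1 hs2
  rw [subdiagonal_eq_of_det_expGram (b := fun j => b j s) hs μ hk hs2]
  exact hs1

theorem spectralWeight_ne_zero {S : Finset ℝ} {a b : ℕ → ℝ}
    (hb : ∀ j, 1 ≤ j → j < n → b j ≠ 0)
    (hS : aeval (hessenberg n a b) (Lagrange.nodal S id) = 0) {μ : ℕ → ℝ}
    (hμ : Set.InjOn μ (Set.Iio n)) (hSμ : S = (Finset.range n).image μ) {i : ℕ} (hi : i < n) :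
    spectralWeight S (hessenberg n a b) (μ i) ≠ 0 := by
  intro hc
  have hmom : ∀ p : ℝ[X], aeval (hessenberg n a b) p 0 0
      = expSum S (fun x => p.eval x * spectralWeight S (hessenberg n a b) x) 0 := by
    intro p
    rw [moment_eq_sum_spectralWeight (by rw [hS]; rfl)]
    simp [expSum]
  have hone : expSum S (spectralWeight S (hessenberg n a b)) 0 = 1 := by
    simpa using (hmom 1).symm
  have hdet := det_expGram_eq (t := 0) (fun p => by rw [hone, mul_one]; exact hmom p) μ le_rfl
  rw [hone] at hdet
  subst hSμ
  rw [det_expGram_zero_of_weight_eq_zero hμ hi hc] at hdet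
  refine absurd hdet.symm (Finset.prod_ne_zero_iff.2 fun p hp => ?_)
  rw [one_mul, subProd, Finset.prod_ne_zero_iff]
  intro j hj
  have := Finset.mem_range.1 hp
  have := Finset.mem_range.1 hj
  exact hb _ (by omega) (by omega)

/-! ### Asymptotics of the subdiagonal entries -/

/-- Along the times `ε * t` (with `ε = 1` for the future and `ε = -1` for the past), let `μ`
enumerate the eigenvalues from the dominant one on. Then the subdiagonal entry of index `k + 1`
decays at the rate given by the consecutive eigenvalues `μ k` and `μ (k + 1)`. -/
theorem IsTodaFlow.tendsto_subdiagonal (hflow : IsTodaFlow n a b)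
    (h0 : TodaRegularAt n a b 0) (hb0 : ∀ j, 1 ≤ j → j < n → b j 0 ≠ 0)
    {S : Finset ℝ} (hS : aeval (todaMatrix n a b 0) (Lagrange.nodal S id) = 0) {μ : ℕ → ℝ}
    (hμ : Set.InjOn μ (Set.Iio n)) (hSμ : S = (Finset.range n).image μ) {ε : ℝ}
    (hε : ∀ i j, i < j → j < n → ε * μ j < ε * μ i) {k : ℕ} (hk : k + 1 < n) :
    (∀ᶠ t in atTop, TodaRegularAt n a b (ε * t)) ∧
    Tendsto (fun t => b (k + 1) (ε * t) * Real.exp (ε * (μ k - μ (k + 1)) * t)) atTop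
      (𝓝 (((newtonPoly μ (k + 1)).eval (μ (k + 1)) ^ 2 *
          spectralWeight S (todaMatrix n a b 0) (μ (k + 1))) /
        ((newtonPoly μ k).eval (μ k) ^ 2 * spectralWeight S (todaMatrix n a b 0) (μ k)))) := by
  set c := spectralWeight S (todaMatrix n a b 0) with hc
  have hcne : ∀ i, i < n → c (μ i) ≠ 0 := fun i hi =>
    spectralWeight_ne_zero hb0 hS hμ hSμ hi
  set g : ℕ → ℝ := fun p => (newtonPoly μ p).eval (μ p) ^ 2 * c (μ p) with hg
  have hgne : ∀ p, p < n → g p ≠ 0 := fun p hp =>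
    mul_ne_zero (pow_ne_zero _ (eval_newtonPoly_self_ne_zero hμ hp)) (hcne p hp)
  have hGne : ∀ m, m ≤ n → ∏ p ∈ Finset.range m, g p ≠ 0 := fun m hm =>
    Finset.prod_ne_zero_iff.2 fun p hp => hgne p ((Finset.mem_range.1 hp).trans_le hm)
  have hlim : ∀ m, m ≤ n → Tendsto (fun t => (∏ p ∈ Finset.range m, Real.exp (-(ε * μ p) * t)) *
      (expGram S c μ m (ε * t)).det) atTop (𝓝 (∏ p ∈ Finset.range m, g p)) := by
    intro m hm
    rw [hSμ]
    exact tendsto_det_expGram hμ hε c hm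
  have hne : ∀ᶠ t in atTop, ∀ m ∈ Finset.range (n + 1), (expGram S c μ m (ε * t)).det ≠ 0 := by
    refine (Finset.eventually_all _).2 fun m hm => ?_
    have hm' : m ≤ n := Nat.lt_succ_iff.1 (Finset.mem_range.1 hm)
    filter_upwards [(hlim m hm').eventually_ne (hGne m hm')] with t ht
    exact right_ne_zero_of_mul ht
  have hreg : ∀ᶠ t in atTop, TodaRegularAt n a b (ε * t) := by
    filter_upwards [hne] with t ht
    exact hflow.regularAt_of_det_expGram_ne_zero h0 hS μ fun m hm =>
      ht m (Finset.mem_range.2 (Nat.lt_succ_of_le hm))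
  refine ⟨hreg, ?_⟩
  have hL := ((hlim (k + 2) hk).div (hlim (k + 1) hk.le) (hGne _ hk.le)).div
    ((hlim (k + 1) hk.le).div (hlim k (by omega)) (hGne _ (by omega)))
    (div_ne_zero (hGne _ hk.le) (hGne _ (by omega)))
  rw [Finset.prod_range_succ (n := k + 1), mul_div_cancel_left₀ _ (hGne _ hk.le),
    Finset.prod_range_succ (n := k), mul_div_cancel_left₀ _ (hGne k (by omega))] at hL
  refine hL.congr' ?_
  filter_upwards [hreg, hne] with t ht htne
  have hm := ht.moment_mul_expSum hflow h0 hS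
  rw [← hc] at hm
  have hd := fun m hm => htne m (Finset.mem_range.2 (Nat.lt_succ_of_le hm))
  rw [subdiagonal_eq_of_det_expGram (b := fun j => b j (ε * t)) hm μ hk (hd _ hk.le)]
  have hE : Real.exp (ε * (μ k - μ (k + 1)) * t)
      = Real.exp (-(ε * μ (k + 1)) * t) / Real.exp (-(ε * μ k) * t) := by
    rw [← Real.exp_sub]
    congr 1
    ring
  have hP : ∏ p ∈ Finset.range k, Real.exp (-(ε * μ p) * t) ≠ 0 :=
    Finset.prod_ne_zero_iff.2 fun p _ => (Real.exp_pos _).ne'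
  have h1 := hd (k + 1) hk.le
  have h2 := hd k (by omega)
  have h3 := (Real.exp_pos (-(ε * μ k) * t)).ne'
  simp only [Pi.div_apply]
  rw [hE, Finset.prod_range_succ (n := k + 1), Finset.prod_range_succ (n := k)]
  generalize ∏ p ∈ Finset.range k, Real.exp (-(ε * μ p) * t) = P at hP ⊢
  generalize Real.exp (-(ε * μ k) * t) = E at h3 ⊢
  generalize Real.exp (-(ε * μ (k + 1)) * t) = E'
  field_simp

end Flow

/-! ### The eigenvalues of the initial matrix -/

theorem aeval_nodal_eq_zero_of_spectrum {n : ℕ} {M : Matrix (Fin n) (Fin n) ℝ} {S : Finset ℝ}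
    (hS : spectrum ℝ M = S) (hcard : S.card = n) : aeval M (Lagrange.nodal S id) = 0 := by
  have hdvd : Lagrange.nodal S id ∣ M.charpoly := by
    refine Finset.prod_dvd_of_coprime
      (fun x _ y _ hxy => pairwise_coprime_X_sub_C Function.injective_id hxy) fun x hx => ?_
    rw [dvd_iff_isRoot]
    exact Matrix.mem_spectrum_iff_isRoot_charpoly.1 (hS ▸ Finset.mem_coe.2 hx)
  have heq : Lagrange.nodal S id = M.charpoly := by
    refine (eq_of_monic_of_dvd_of_natDegree_le Lagrange.nodal_monic
      M.charpoly_monic hdvd ?_).symm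
    rw [Lagrange.natDegree_nodal, hcard, M.charpoly_natDegree_eq_dim, Fintype.card_fin]
  rw [heq, M.aeval_self_charpoly]

/-! ### The product of the two asymptotics -/

theorem mainTheorem2 (n k : ℕ) (hk1 : 1 ≤ k) (hkn : k < n)
    (lam : ℕ → ℝ) (hlam : StrictAntiOn lam (Set.Icc 1 n))
    (a b : ℕ → ℝ → ℝ) (hflow : IsTodaFlow n a b)
    (h0 : TodaRegularAt n a b 0)
    (hb0 : ∀ j : ℕ, 1 ≤ j → j < n → b j 0 ≠ 0)
    (hspec : spectrum ℝ (todaMatrix n a b 0) = lam '' Set.Icc 1 n) :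
    (∀ᶠ t : ℝ in atTop, TodaRegularAt n a b t ∧ TodaRegularAt n a b (-t)) ∧
    Tendsto
      (fun t : ℝ => b (n - k) t * b k (-t) *
        Real.exp (2 * (lam (n - k) - lam (n - k + 1)) * t))
      atTop
      (𝓝 (((∏ j ∈ Finset.Icc 1 k, (lam (n - k) - lam (n - j + 1)) ^ 2) *
            (∏ j ∈ Finset.Icc (k + 1) n, (lam (n - k + 1) - lam (n - j + 1)) ^ 2)) /
          ((∏ j ∈ Finset.Icc (k + 2) n, (lam (n - k) - lam (n - j + 1)) ^ 2) *
            (∏ j ∈ Finset.Icc 1 (k - 1), (lam (n - k + 1) - lam (n - j + 1)) ^ 2)))) := by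
  have : NeZero n := ⟨by omega⟩
  obtain ⟨l, rfl⟩ : ∃ l, k = l + 1 := ⟨k - 1, by omega⟩
  obtain ⟨m, rfl⟩ : ∃ m, n = l + 1 + (m + 1) := ⟨n - (l + 1) - 1, by omega⟩
  set N := l + 1 + (m + 1) with hN
  have hNk : N - (l + 1) = m + 1 := by omega
  -- the eigenvalues in decreasing and in increasing order, dominant at `+∞` and at `-∞`
  set μ : ℕ → ℝ := fun i => lam (i + 1) with hμ
  set ρ : ℕ → ℝ := fun i => lam (N - i) with hρ
  have hanti : ∀ i j, 1 ≤ i → i < j → j ≤ N → lam j < lam i := fun i j hi hij hj =>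
    hlam ⟨hi, by omega⟩ ⟨by omega, hj⟩ hij
  have hμε : ∀ i j, i < j → j < N → 1 * μ j < 1 * μ i := fun i j hij hj => by
    simpa [hμ] using hanti (i + 1) (j + 1) (by omega) (by omega) (by omega)
  have hρε : ∀ i j, i < j → j < N → -1 * ρ j < -1 * ρ i := fun i j hij hj => by
    simpa [hρ] using hanti (N - j) (N - i) (by omega) (by omega) (by omega)
  have hμinj : Set.InjOn μ (Set.Iio N) := fun i hi j hj hij => by
    have := hlam.injOn (show i + 1 ∈ Set.Icc 1 N from ⟨by omega, hi⟩)
      (show j + 1 ∈ Set.Icc 1 N from ⟨by omega, hj⟩) hij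
    omega
  have hρinj : Set.InjOn ρ (Set.Iio N) := fun i hi j hj hij => by
    have hi' := Set.mem_Iio.1 hi
    have hj' := Set.mem_Iio.1 hj
    have := hlam.injOn (show N - i ∈ Set.Icc 1 N from ⟨by omega, by omega⟩)
      (show N - j ∈ Set.Icc 1 N from ⟨by omega, by omega⟩) hij
    omega
  set S : Finset ℝ := (Finset.range N).image μ with hSμ
  have hSρ : S = (Finset.range N).image ρ := by
    ext x
    simp only [hSμ, Finset.mem_image, Finset.mem_range]
    constructor <;> rintro ⟨i, hi, rfl⟩ <;> refine ⟨N - 1 - i, by omega, ?_⟩ <;>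
      simp only [hμ, hρ] <;> congr 1 <;> omega
  have hSspec : spectrum ℝ (todaMatrix N a b 0) = S := by
    rw [hspec, hSμ]
    ext x
    simp only [Finset.coe_image, Finset.coe_range, Set.mem_image, Set.mem_Icc, Set.mem_Iio, hμ]
    constructor
    · rintro ⟨i, hi, rfl⟩
      exact ⟨i - 1, by omega, by rw [Nat.sub_add_cancel hi.1]⟩
    · rintro ⟨i, hi, rfl⟩
      exact ⟨i + 1, by omega, rfl⟩
  have hcard : S.card = N := by
    rw [hSμ, Finset.card_image_of_injOn (by simpa using hμinj), Finset.card_range]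
  have hS := aeval_nodal_eq_zero_of_spectrum hSspec hcard
  obtain ⟨hreg1, hlim1⟩ := hflow.tendsto_subdiagonal h0 hb0 hS hμinj hSμ hμε
    (k := m) (by omega)
  obtain ⟨hreg2, hlim2⟩ := hflow.tendsto_subdiagonal h0 hb0 hS hρinj hSρ hρε
    (k := l) (by omega)
  set c := spectralWeight S (todaMatrix N a b 0) with hc
  have hcne : ∀ i, i < N → c (μ i) ≠ 0 := fun i hi =>
    spectralWeight_ne_zero hb0 hS hμinj hSμ hi
  simp only [one_mul, neg_one_mul] at hreg1 hreg2 hlim1 hlim2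
  refine ⟨hreg1.and hreg2, ?_⟩
  have hρl : ρ l = μ (m + 1) := congrArg lam (by omega)
  have hρl' : ρ (l + 1) = μ m := congrArg lam (by omega)
  have hprod := hlim1.mul hlim2
  have hμ1 : lam (m + 1) = μ m := rfl
  have hμ2 : lam (m + 1 + 1) = μ (m + 1) := rfl
  rw [hNk, hμ1, hμ2]
  -- the Newton polynomials give the products over the eigenvalues on one side
  have hdown : ∀ x : ℝ, ∀ i, i ≤ N → ∏ j ∈ Finset.Icc (N - i + 1) N, (x - lam (N - j + 1)) ^ 2
      = (newtonPoly μ i).eval x ^ 2 := by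
    intro x i hi
    rw [eval_newtonPoly, ← Finset.prod_pow]
    refine Finset.prod_bij' (fun j _ => N - j) (fun j _ => N - j) ?_ ?_ ?_ ?_ ?_ <;>
      simp only [Finset.mem_Icc, Finset.mem_range]
    · omega
    · omega
    · omega
    · omega
    · intro j hj
      rfl
  have hup : ∀ x : ℝ, ∀ i, i ≤ N → ∏ j ∈ Finset.Icc 1 i, (x - lam (N - j + 1)) ^ 2
      = (newtonPoly ρ i).eval x ^ 2 := by
    intro x i hi
    rw [eval_newtonPoly, ← Finset.prod_pow]
    refine Finset.prod_bij' (fun j _ => j - 1) (fun j _ => j + 1) ?_ ?_ ?_ ?_ ?_ <;>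
      simp only [Finset.mem_Icc, Finset.mem_range]
    · omega
    · omega
    · omega
    · omega
    · intro j hj
      simp only [hρ, show N - (j - 1) = N - j + 1 by omega]
  rw [hup _ _ (by omega), hup _ _ (by omega), show l + 1 + 1 = N - (m + 1) + 1 by omega,
    show l + 1 + 2 = N - m + 1 by omega, hdown _ _ (by omega), hdown _ _ (by omega)]
  rw [hρl, hρl'] at hprod
  -- the two weights cancel
  have hc1 := hcne m (by omega)
  have hc2 := hcne (m + 1) (by omega)
  refine Tendsto.congr (fun t => ?_) (hprod.trans_eq ?_)
  · rw [mul_mul_mul_comm, ← Real.exp_add]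
    congr 2
    ring
  · rw [Nat.add_sub_cancel]
    congr 1
    field_simp
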